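/- Let $A\in\mathbb R^{n\times n}$ and $C\in\mathbb R^{N\times n}$, and consider the system $x(k+1)=Ax(k)$, $y(k)=Cx(k)$ (noise omitted), where every sensor $i\in\{1,\dots,N\}$ has exactly one state output: row $i$ of $C$ has exactly one nonzero entry, in some column $s(i)\in\{1,\dots,n\}$. Let $\mathcal G_A=(\mathcal V,\mathcal E)$ be the system digraph: $\mathcal V=\{1,\dots,n\}$ and $(i,j)\in\mathcal E$ if and only if $A_{ji}\neq 0$ (self-loops allowed). A *parent SCC* is a strongly connected component of $\mathcal G_A$ with no outgoing link to any other strongly connected component (a single node reaches itself by the trivial path). A *contraction* is a set $\mathcal C\subseteq\mathcal V$ with $|\mathcal N(\mathcal C)|<|\mathcal C|$, where $\mathcal N(\mathcal C)=\{j : (i,j)\in\mathcal E \text{ for some } i\in\mathcal C\}$. A pair $(A,C)$ is *observable* if $x(0)$ is determined by the sequence $(CA^kx(0))_{k\ge 0}$. It is *structurally observable* if, when the zero entries of $A$ and $C$ are kept fixed and the nonzero entries are replaced by free real parameters, all parameter values for which the resulting pair is not observable lie on the zero set of a real polynomial in these parameters, and this zero set has Lebesgue measure zero. Let $Q\ge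 0$ be an integer. Suppose that every parent SCC and every contraction of $\mathcal G_A$ contains at least $Q+1$ distinct state nodes whose outputs are measured by sensors, that is, at least $Q+1$ elements of $\{s(1),\dots,s(N)\}$. Then, for every set $R$ of at most $Q$ sensors, the pair $(A,\overline C_R)$ is structurally observable, where $\overline C_R$ is the matrix obtained from $C$ by deleting the rows in $R$. -/

import Mathlib

/-! ### Linear systems: observability -/

/-- The pair `(A, C)` is observable: for the noise-free system `x(k+1) = A x(k)`, `y(k) = C x(k)`,
the output sequence `k ↦ C A ^ k x(0)` determines the initial state `x(0)`. -/
def PairObservable {ι κ : Type*} [Fintype ι] [DecidableEq ι]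
    (A : Matrix ι ι ℝ) (C : Matrix κ ι ℝ) : Prop :=
  Function.Injective (fun (x : ι → ℝ) (k : ℕ) => C.mulVec ((A ^ k).mulVec x))

/-! ### Linear systems: structural (generic) observability -/

/-- The free parameters of the structure of `(A, C)`: one for every nonzero entry of `A` and one for
every nonzero entry of `C`. -/
abbrev FreeParam {ι κ : Type*} (A : Matrix ι ι ℝ) (C : Matrix κ ι ℝ) : Type _ :=
  {e : ι × ι // A e.1 e.2 ≠ 0} ⊕ {e : κ × ι // C e.1 e.2 ≠ 0}

open scoped Classical in
/-- The state matrix with the zero pattern of `A` and the free entries given by `θ`. -/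
noncomputable def realizeA {ι κ : Type*} (A : Matrix ι ι ℝ) (C : Matrix κ ι ℝ)
    (θ : FreeParam A C → ℝ) : Matrix ι ι ℝ :=
  Matrix.of fun i j => if h : A i j ≠ 0 then θ (Sum.inl ⟨(i, j), h⟩) else 0

open scoped Classical in
/-- The output matrix with the zero pattern of `C` and the free entries given by `θ`. -/
noncomputable def realizeC {ι κ : Type*} (A : Matrix ι ι ℝ) (C : Matrix κ ι ℝ)
    (θ : FreeParam A C → ℝ) : Matrix κ ι ℝ :=
  Matrix.of fun i j => if h : C i j ≠ 0 then θ (Sum.inr ⟨(i, j), h⟩) else 0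

open scoped Classical in
/-- `(A, C)` is structurally observable: the values of the free parameters for which the pair is not
observable all lie on an algebraic hypersurface of Lebesgue measure zero in the parameter space. -/
def StructurallyObservable {ι κ : Type*} [Fintype ι] [DecidableEq ι] [Fintype κ]
    (A : Matrix ι ι ℝ) (C : Matrix κ ι ℝ) : Prop :=
  ∃ p : MvPolynomial (FreeParam A C) ℝ,
    MeasureTheory.volume {θ : FreeParam A C → ℝ | MvPolynomial.eval θ p = 0} = 0 ∧
    ∀ θ : FreeParam A C → ℝ,
      ¬ PairObservable (realizeA A C θ) (realizeC A C θ) → MvPolynomial.eval θ p = 0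

/-! ### The system digraph, its parent strongly connected components and its contractions -/

/-- The system digraph of `A`: there is a link from `i` to `j` iff `A j i ≠ 0`, that is, iff state
`i` enters the update of state `j`.  Self-loops are allowed. -/
def systemDigraph {ι : Type*} (A : Matrix ι ι ℝ) : Digraph ι where
  Adj i j := A j i ≠ 0

/-- There is a directed path (possibly of length zero) from `i` to `j`. -/
def HasPath {V : Type*} (G : Digraph V) (i j : V) : Prop :=
  Relation.ReflTransGen G.Adj i j

/-- `S` is a strongly connected component: a class of mutually reachable nodes. -/
def IsSCC {V : Type*} (G : Digraph V) (S : Set V) : Prop :=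
  ∃ i, S = {j | HasPath G i j ∧ HasPath G j i}

/-- `S` is a parent strongly connected component: it has no outgoing link to any other one. -/
def IsParentSCC {V : Type*} (G : Digraph V) (S : Set V) : Prop :=
  IsSCC G S ∧ ∀ T, IsSCC G T → T ≠ S → ∀ i ∈ S, ∀ j ∈ T, ¬ G.Adj i j

/-- The set of all out-neighbours of nodes of `K`. -/
def outNbhd {V : Type*} (G : Digraph V) (K : Set V) : Set V :=
  {j | ∃ i ∈ K, G.Adj i j}

/-- `K` is a contraction: it has fewer out-neighbours than elements (used for finite `V`). -/
def IsContraction {V : Type*} (G : Digraph V) (K : Set V) : Prop :=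
  (outNbhd G K).ncard < K.ncard

/-! ### Sensors -/

/-- `C` is the output matrix in which sensor `i` has a single state output, that of state `s i`. -/
def IsStateOutputMatrix {ι κ : Type*} (C : Matrix κ ι ℝ) (s : κ → ι) : Prop :=
  ∀ i j, C i j ≠ 0 ↔ j = s i

/-- The output matrix left after the sensors (rows) in `R` have been removed. -/
def removeRows {ι κ : Type*} (C : Matrix κ ι ℝ) (R : Finset κ) :
    Matrix {i : κ // i ∉ R} ι ℝ :=
  C.submatrix Subtype.val id

/-! Deleting at most `Q` sensors unmeasures at most `Q` states, so every parent SCC and every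
contraction keeps a measured state; what remains is Lin's criterion. Non-observability is the
vanishing of a Gramian determinant, a polynomial in the free parameters, so one observable
realization suffices (`structurallyObservable_of_exists`). In the eigenvector test the columns of
measured states play no role. Hall's theorem gives a permutation following links off the measured
set (`exists_perm_of_contraction`), and parent SCCs give every state a path to that set.
`exists_pencilInjective` builds the realization from the cycles of the permutation: each new cycle
gets a larger weight than the earlier ones and either a link into them or a measured state.
`PencilInjective.of_addCycle` is the inductive step. -/

/-! ### Zero sets of real polynomials -/

open MeasureTheory in
theorem MvPolynomial.volume_zeroSet_fin (n : ℕ) (p : MvPolynomial (Fin n) ℝ) (hp : p ≠ 0) :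
    volume {x : Fin n → ℝ | MvPolynomial.eval x p = 0} = 0 := by
  induction n with
  | zero =>
    obtain ⟨x, hx⟩ : ∃ x, MvPolynomial.eval x p ≠ 0 := by
      by_contra! h
      exact hp (MvPolynomial.funext fun x => by simpa using h x)
    convert measure_empty (μ := (volume : Measure (Fin 0 → ℝ)))
    ext y
    simpa [Subsingleton.elim y x] using hx
  | succ n ih =>
    have hq : MvPolynomial.finSuccEquiv ℝ n p ≠ 0 := by simpa using hp
    obtain ⟨k, hk⟩ : ∃ k, (MvPolynomial.finSuccEquiv ℝ n p).coeff k ≠ 0 := by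
      by_contra! h
      exact hq (Polynomial.ext fun k => by simpa using h k)
    have hmeas : MeasurableSet {x : Fin (n + 1) → ℝ | MvPolynomial.eval x p = 0} :=
      (isClosed_singleton.preimage (MvPolynomial.continuous_eval p)).measurableSet
    have hmp := (volume_preserving_piFinSuccAbove (fun _ : Fin (n + 1) => ℝ) 0).symm
    rw [← hmp.measure_preimage hmeas.nullMeasurableSet, Measure.volume_eq_prod,
      Measure.prod_apply_symm (hmp.measurable hmeas), lintegral_eq_zero_iff
        (measurable_measure_prodMk_right (hmp.measurable hmeas))]
    -- Fubini: off the null set where the `k`-th coefficient vanishes, each slice is the root set of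
    -- a nonzero univariate polynomial, hence finite.
    have hae : ∀ᵐ x : Fin n → ℝ,
        MvPolynomial.eval x ((MvPolynomial.finSuccEquiv ℝ n p).coeff k) ≠ 0 :=
      measure_eq_zero_iff_ae_notMem.1 (ih _ hk)
    filter_upwards [hae] with x hx
    have hr : (MvPolynomial.finSuccEquiv ℝ n p).map (MvPolynomial.eval x) ≠ 0 := fun h => hx <| by
      simpa using congrArg (fun f => Polynomial.coeff f k) h
    refine measure_mono_null (fun y hy => ?_)
      (((MvPolynomial.finSuccEquiv ℝ n p).map (MvPolynomial.eval x)).roots.toFinset.finite_toSet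
        |>.measure_zero volume)
    have hy' : MvPolynomial.eval (Fin.cons y x : Fin (n + 1) → ℝ) p = 0 := by
      simpa [MeasurableEquiv.piFinSuccAbove, Fin.insertNthEquiv] using hy
    rw [MvPolynomial.eval_eq_eval_mv_eval'] at hy'
    simpa [hr] using hy'

open MeasureTheory in
/-- The zero set of a nonzero real polynomial in finitely many variables is a null set. -/
theorem MvPolynomial.volume_zeroSet {σ : Type*} [Fintype σ] (p : MvPolynomial σ ℝ) (hp : p ≠ 0) :
    volume {x : σ → ℝ | MvPolynomial.eval x p = 0} = 0 := by
  let e := Fintype.equivFin σ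
  have hmp := volume_measurePreserving_piCongrLeft (fun _ : Fin (Fintype.card σ) => ℝ) e
  have hq : MvPolynomial.rename e p ≠ 0 := fun h =>
    hp (MvPolynomial.rename_injective e e.injective (by simpa using h))
  have hmeas : MeasurableSet {x | MvPolynomial.eval x (MvPolynomial.rename e p) = 0} :=
    (isClosed_singleton.preimage (MvPolynomial.continuous_eval _)).measurableSet
  rw [← MvPolynomial.volume_zeroSet_fin _ _ hq, ← hmp.measure_preimage hmeas.nullMeasurableSet]
  congr 1
  ext x
  have : (MeasurableEquiv.piCongrLeft (fun _ : Fin (Fintype.card σ) => ℝ) e x) ∘ e = x := by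
    ext i
    exact Equiv.piCongrLeft_apply_apply (fun _ => ℝ) e x i
  simp [MvPolynomial.eval_rename, this]

/-! ### Observability tests and genericity -/

/-- A real pair without a complex eigenvector in the kernel of the output matrix is observable. -/
theorem pairObservable_of_eigenvector {ι κ : Type*} [Fintype ι] [DecidableEq ι]
    (A : Matrix ι ι ℝ) (C : Matrix κ ι ℝ)
    (h : ∀ (μ : ℂ) (v : ι → ℂ), (A.map (algebraMap ℝ ℂ)).mulVec v = μ • v →
      (C.map (algebraMap ℝ ℂ)).mulVec v = 0 → v = 0) : PairObservable A C := by
  set A' := A.map (algebraMap ℝ ℂ) with hA'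
  set C' := C.map (algebraMap ℝ ℂ) with hC'
  intro x y hxy
  -- The complex unobservable subspace is invariant, so if nonzero it contains an eigenvector.
  let U : Submodule ℂ (ι → ℂ) :=
    { carrier := {v | ∀ k : ℕ, C'.mulVec ((A' ^ k).mulVec v) = 0}
      add_mem' := fun {a b} ha hb k => by simp [Matrix.mulVec_add, ha k, hb k]
      zero_mem' := fun k => by simp
      smul_mem' := fun c a ha k => by simp [Matrix.mulVec_smul, ha k] }
  have hU : ∀ v ∈ U, A'.mulVecLin v ∈ U := fun v hv k => by
    simpa [pow_succ, Matrix.mulVec_mulVec] using hv (k + 1)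
  have hz : (fun i => algebraMap ℝ ℂ ((x - y) i)) ∈ U := fun k => by
    have h1 : C.mulVec ((A ^ k).mulVec (x - y)) = 0 := by
      rw [Matrix.mulVec_sub, Matrix.mulVec_sub, sub_eq_zero]
      exact congrFun hxy k
    ext i
    have h2 := congrArg (algebraMap ℝ ℂ) (congrFun h1 i)
    rw [Matrix.mulVec_mulVec, RingHom.map_mulVec] at h2
    rw [hA', hC', Matrix.mulVec_mulVec, ← Matrix.map_pow, ← Matrix.map_mul]
    exact h2.trans (by simp)
  have hbot : U = ⊥ := by
    by_contra hne
    have : Nontrivial U := Submodule.nontrivial_iff_ne_bot.2 hne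
    obtain ⟨μ, hμ⟩ := Module.End.exists_eigenvalue (A'.mulVecLin.restrict hU)
    obtain ⟨v, hv⟩ := hμ.exists_hasEigenvector
    refine hv.2 (Subtype.ext (h μ v ?_ ?_))
    · simpa using congrArg Subtype.val hv.apply_eq_smul
    · simpa using v.2 0
  rw [hbot, Submodule.mem_bot] at hz
  ext i
  have := congrFun hz i
  simpa [sub_eq_zero] using this

/-- Finitely many outputs suffice: the outputs at times `k < n` determine all later ones. -/
theorem output_eq_zero_of_lt_card {ι κ : Type*} [Fintype ι] [DecidableEq ι]
    (A : Matrix ι ι ℝ) (C : Matrix κ ι ℝ) (z : ι → ℝ)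
    (h : ∀ k < Fintype.card ι, (C * A ^ k).mulVec z = 0) (k : ℕ) : (C * A ^ k).mulVec z = 0 := by
  rcases isEmpty_or_nonempty ι with hι | hι
  · simp [Subsingleton.elim z 0]
  rw [Matrix.pow_eq_aeval_mod_charpoly A k, Polynomial.aeval_eq_sum_range' (n := Fintype.card ι),
    Matrix.mul_sum, Matrix.sum_mulVec]
  · refine Finset.sum_eq_zero fun i hi => ?_
    rw [Matrix.mul_smul, Matrix.smul_mulVec, h i (Finset.mem_range.1 hi), smul_zero]
  · refine (Polynomial.natDegree_modByMonic_lt _ A.charpoly_monic ?_).trans_eq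
      A.charpoly_natDegree_eq_dim
    intro h1
    have := A.charpoly_natDegree_eq_dim
    rw [h1, Polynomial.natDegree_one] at this
    exact Fintype.card_ne_zero this.symm

/-- The observability Gramian over a general commutative ring. -/
def obsGram {ι κ R : Type*} [Fintype ι] [DecidableEq ι] [Fintype κ] [CommRing R]
    (A : Matrix ι ι R) (C : Matrix κ ι R) : Matrix ι ι R :=
  ∑ k ∈ Finset.range (Fintype.card ι), (C * A ^ k).transpose * (C * A ^ k)

theorem obsGram_map {ι κ R S : Type*} [Fintype ι] [DecidableEq ι] [Fintype κ] [CommRing R]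
    [CommRing S] (f : R →+* S) (A : Matrix ι ι R) (C : Matrix κ ι R) :
    (obsGram A C).map f = obsGram (A.map f) (C.map f) := by
  simp only [obsGram, ← RingHom.mapMatrix_apply, map_sum]
  simp [Matrix.map_mul, Matrix.transpose_map, Matrix.map_pow]

/-- Over `ℝ` the quadratic form of the Gramian at `z` is the sum of the squared norms of the
outputs, so a kernel vector has zero outputs at times `k < n`, hence always. -/
theorem det_obsGram_ne_zero_iff {ι κ : Type*} [Fintype ι] [DecidableEq ι] [Fintype κ]
    (A : Matrix ι ι ℝ) (C : Matrix κ ι ℝ) : (obsGram A C).det ≠ 0 ↔ PairObservable A C := by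
  rw [Ne, ← Matrix.exists_mulVec_eq_zero_iff]
  constructor
  · intro h x y hxy
    by_contra hne
    refine h ⟨x - y, sub_ne_zero.2 hne, ?_⟩
    rw [obsGram, Matrix.sum_mulVec]
    refine Finset.sum_eq_zero fun k _ => ?_
    rw [← Matrix.mulVec_mulVec, Matrix.mulVec_sub (C * A ^ k), ← Matrix.mulVec_mulVec,
      ← Matrix.mulVec_mulVec, sub_eq_zero.2 (congrFun hxy k), Matrix.mulVec_zero]
  · rintro h ⟨z, hz0, hz⟩
    refine hz0 (h ?_)
    have hsum : ∑ k ∈ Finset.range (Fintype.card ι),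
        (C * A ^ k).mulVec z ⬝ᵥ (C * A ^ k).mulVec z = 0 := by
      have h1 : z ⬝ᵥ (obsGram A C).mulVec z = 0 := by rw [hz, dotProduct_zero]
      rw [obsGram, Matrix.sum_mulVec, dotProduct_sum] at h1
      rw [← h1]
      refine Finset.sum_congr rfl fun k _ => ?_
      rw [← Matrix.mulVec_mulVec z (C * A ^ k).transpose,
        Matrix.dotProduct_mulVec z (C * A ^ k).transpose,
        Matrix.vecMul_transpose]
    rw [Finset.sum_eq_zero_iff_of_nonneg fun k _ => by
      exact Finset.sum_nonneg fun i _ => mul_self_nonneg _] at hsum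
    funext k
    have := output_eq_zero_of_lt_card A C z
      (fun k hk => dotProduct_self_eq_zero.1 (hsum k (Finset.mem_range.2 hk))) k
    simpa [Matrix.mulVec_mulVec] using this

theorem structurallyObservable_of_exists {ι κ : Type*} [Fintype ι] [DecidableEq ι] [Fintype κ]
    (A : Matrix ι ι ℝ) (C : Matrix κ ι ℝ)
    (h : ∃ θ, PairObservable (realizeA A C θ) (realizeC A C θ)) : StructurallyObservable A C := by
  classical
  let A' : Matrix ι ι (MvPolynomial (FreeParam A C) ℝ) := Matrix.of fun i j =>
    if h : A i j ≠ 0 then MvPolynomial.X (Sum.inl ⟨(i, j), h⟩) else 0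
  let C' : Matrix κ ι (MvPolynomial (FreeParam A C) ℝ) := Matrix.of fun i j =>
    if h : C i j ≠ 0 then MvPolynomial.X (Sum.inr ⟨(i, j), h⟩) else 0
  have hA : ∀ θ, A'.map (MvPolynomial.eval θ) = realizeA A C θ := fun θ => by
    ext i j
    simp only [A', realizeA, Matrix.map_apply, Matrix.of_apply]
    split_ifs <;> simp
  have hC : ∀ θ, C'.map (MvPolynomial.eval θ) = realizeC A C θ := fun θ => by
    ext i j
    simp only [C', realizeC, Matrix.map_apply, Matrix.of_apply]
    split_ifs <;> simp
  have hdet : ∀ θ, MvPolynomial.eval θ (obsGram A' C').det =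
      (obsGram (realizeA A C θ) (realizeC A C θ)).det := fun θ => by
    rw [RingHom.map_det, RingHom.mapMatrix_apply, obsGram_map, hA, hC]
  refine ⟨(obsGram A' C').det, ?_, fun θ hθ => ?_⟩
  · obtain ⟨θ, hθ⟩ := h
    rw [← det_obsGram_ne_zero_iff, ← hdet] at hθ
    convert MvPolynomial.volume_zeroSet (obsGram A' C').det (fun h0 => hθ (by simp [h0]))
  · rw [hdet]
    by_contra hne
    exact hθ ((det_obsGram_ne_zero_iff _ _).1 hne)

/-! ### Building a realization cycle by cycle -/

/-- The pencil `μ - B` is injective on the complex vectors supported on `W` that vanish on `M`, and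
for large `μ` it does not even map a nonzero one of them to a multiple of a coordinate vector. -/
def PencilInjective {ι : Type*} [Fintype ι] [DecidableEq ι] (B : Matrix ι ι ℝ) (M W : Set ι)
    (ρ : ℝ) : Prop :=
  ∀ (μ c : ℂ) (j : ι) (v : ι → ℂ), (∀ y ∉ W, v y = 0) → (∀ m ∈ M, v m = 0) →
    (∀ y ∈ W, μ * v y - ∑ x, (B y x : ℂ) * v x = if y = j then c else 0) →
    (c = 0 ∨ ρ < ‖μ‖) → v = 0

/-- Going round `orderOf σ` times gives `μ ^ k * v y = l ^ k * v y`, which forces `‖μ‖ = l` unless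
`v y = 0`. -/
theorem cycle_eq_zero_of_norm_ne {ι : Type*} [Finite ι] (σ : Equiv.Perm ι) (i : ι) (μ : ℂ) (l : ℝ)
    (hl : 0 < l) (hμ : ‖μ‖ ≠ l) (v : ι → ℂ)
    (h : ∀ y, σ.SameCycle i y → μ * v y = l * v (σ⁻¹ y)) (y : ι) (hy : σ.SameCycle i y) :
    v y = 0 := by
  have key : ∀ k : ℕ, μ ^ k * v ((σ ^ k) y) = (l : ℂ) ^ k * v y := by
    intro k
    induction k with
    | zero => simp
    | succ k ih =>
      have h1 := h ((σ ^ (k + 1)) y) (by simpa using hy)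
      have h2 : σ⁻¹ ((σ ^ (k + 1)) y) = (σ ^ k) y := by simp [pow_succ']
      rw [h2] at h1
      rw [pow_succ, mul_assoc, h1, mul_left_comm, ih]
      ring
  have h1 := congrArg norm (key (orderOf σ))
  rw [pow_orderOf_eq_one, Equiv.Perm.one_apply, norm_mul, norm_mul, norm_pow, norm_pow,
    Complex.norm_real, Real.norm_of_nonneg hl.le] at h1
  by_contra hv
  exact hμ ((pow_left_inj₀ (norm_nonneg _) hl.le (orderOf_pos σ).ne').1
    (mul_right_cancel₀ (norm_ne_zero_iff.2 hv) h1))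

/-- The source enters only at `j`, so a nonzero `v j` would propagate to `i`; hence `v j = 0`, and
this zero propagates round the cycle. -/
theorem cycle_eq_zero_of_apply_eq_zero {ι : Type*} [Finite ι] [DecidableEq ι] (σ : Equiv.Perm ι)
    (i j : ι) (hj : σ.SameCycle i j) (μ c : ℂ) (l : ℝ) (hl : l ≠ 0) (hμ : μ ≠ 0) (v : ι → ℂ)
    (hi : v i = 0)
    (h : ∀ y, σ.SameCycle i y → μ * v y = l * v (σ⁻¹ y) + if y = j then c else 0)
    (y : ι) (hy : σ.SameCycle i y) : v y = 0 := by
  have hl' : (l : ℂ) ≠ 0 := by exact_mod_cast hl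
  have step : ∀ k : ℕ, (σ ^ (k + 1)) j ≠ j → μ * v ((σ ^ (k + 1)) j) = l * v ((σ ^ k) j) := by
    intro k hk
    have h1 := h ((σ ^ (k + 1)) j) (by simpa using hj)
    have h2 : σ⁻¹ ((σ ^ (k + 1)) j) = (σ ^ k) j := by simp [pow_succ']
    rwa [h2, if_neg hk, add_zero] at h1
  have hvj : v j = 0 := by
    by_contra hne
    have hall : ∀ k : ℕ, v ((σ ^ k) j) ≠ 0 := by
      intro k
      induction k with
      | zero => simpa using hne
      | succ k ih =>
        by_cases hk : (σ ^ (k + 1)) j = j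
        · rwa [hk]
        · intro h0
          have := step k hk
          rw [h0, mul_zero] at this
          exact mul_ne_zero hl' ih this.symm
    obtain ⟨k, -, hk⟩ := hj.symm.exists_pow_eq'
    exact hall k (by rw [hk, hi])
  have hall : ∀ k : ℕ, v ((σ ^ k) j) = 0 := by
    intro k
    induction k with
    | zero => simpa using hvj
    | succ k ih =>
      by_cases hk : (σ ^ (k + 1)) j = j
      · rwa [hk]
      · have := step k hk
        rw [ih, mul_zero] at this
        exact (mul_eq_zero.1 this).resolve_left hμ
  obtain ⟨k, -, hk⟩ := (hj.symm.trans hy).exists_pow_eq'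
  rw [← hk, hall]

open scoped Classical in
/-- `B` enlarged by the cycle of `σ` through `i`, with weight `l`, and by a link from `i` to `j`. -/
noncomputable def addCycle {ι : Type*} (B : Matrix ι ι ℝ) (σ : Equiv.Perm ι) (l : ℝ) (i j : ι) :
    Matrix ι ι ℝ :=
  Matrix.of fun y x => B y x + (if x = σ⁻¹ y then if σ.SameCycle i y then l else 0 else 0) +
    if x = i then if y = j then 1 else 0 else 0

theorem addCycle_ne_zero {ι : Type*} {B : Matrix ι ι ℝ} {σ : Equiv.Perm ι} {l : ℝ} {i j y x : ι}
    (h : addCycle B σ l i j y x ≠ 0) :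
    B y x ≠ 0 ∨ (x = σ⁻¹ y ∧ σ.SameCycle i y) ∨ (x = i ∧ y = j) := by
  contrapose! h
  obtain ⟨h1, h2, h3⟩ := h
  simp only [addCycle, Matrix.of_apply, h1]
  split_ifs <;> simp_all

/-- If `j` is on the new cycle and `ρ < ‖μ‖`, the only source on `W` is `v i` at `j₀`; the
coordinate-vector clause of `hB` gives `v = 0` on `W`, then `v i = 0`, then zero on the cycle.
Otherwise the cycle has no source and `‖μ‖ ≠ ρ + 1`, the modulus of its eigenvalues, so `v` vanishes
there and `hB` applies on `W`. -/
theorem PencilInjective.of_addCycle {ι : Type*} [Fintype ι] [DecidableEq ι] {B : Matrix ι ι ℝ}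
    {M W : Set ι} {ρ : ℝ} (hρ : 0 ≤ ρ) (hB : PencilInjective B M W ρ)
    (hBW : ∀ y x, B y x ≠ 0 → y ∈ W ∧ x ∈ W) (σ : Equiv.Perm ι) (hσ : ∀ y, σ y ∈ W ↔ y ∈ W)
    (i j₀ : ι) (hi : i ∉ W) (hij : i ∈ M ∨ j₀ ∈ W) :
    PencilInjective (addCycle B σ (ρ + 1) i j₀) M (W ∪ {y | σ.SameCycle i y}) (ρ + 1) := by
  classical
  intro μ c j v hvW hvM hv hc
  have hdisj : ∀ y, σ.SameCycle i y → y ∉ W := by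
    intro y hy hyW
    obtain ⟨k, -, hk⟩ := hy.symm.exists_pow_eq'
    have : ∀ k : ℕ, (σ ^ k) y ∈ W := by
      intro k
      induction k with
      | zero => simpa using hyW
      | succ k ih => rw [pow_succ', Equiv.Perm.mul_apply, hσ]; exact ih
    exact hi (hk ▸ this k)
  have hsum : ∀ y, ∑ x, ((addCycle B σ (ρ + 1) i j₀) y x : ℂ) * v x = ∑ x, (B y x : ℂ) * v x +
      (if σ.SameCycle i y then ((ρ + 1 : ℝ) : ℂ) * v (σ⁻¹ y) else 0) +
      if y = j₀ then v i else 0 := by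
    intro y
    simp only [addCycle, Matrix.of_apply, Complex.ofReal_add, add_mul,
      Finset.sum_add_distrib, apply_ite Complex.ofReal, ite_mul, Complex.ofReal_zero, zero_mul,
      Finset.sum_ite_eq', Finset.mem_univ, if_true, Complex.ofReal_one, one_mul]
  -- the restriction of `v` to `W`
  set w : ι → ℂ := W.indicator v with hw
  have hBw : ∀ y, ∑ x, (B y x : ℂ) * v x = ∑ x, (B y x : ℂ) * w x := fun y =>
    Finset.sum_congr rfl fun x _ => by
      by_cases hx : x ∈ W
      · rw [hw, Set.indicator_of_mem hx]
      · rw [not_not.1 fun h => hx (hBW y x h).2]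
        simp
  have hw0 : ∀ y ∉ W, w y = 0 := fun y hy => Set.indicator_of_notMem hy v
  have hwM : ∀ m ∈ M, w m = 0 := fun m hm => by
    by_cases h : m ∈ W
    · rw [hw, Set.indicator_of_mem h, hvM m hm]
    · exact hw0 m h
  have eqW : ∀ y ∈ W, μ * w y - ∑ x, (B y x : ℂ) * w x =
      (if y = j₀ then v i else 0) + if y = j then c else 0 := by
    intro y hy
    have h1 := hv y (Or.inl hy)
    rw [hsum, if_neg fun h => hdisj y h hy, hBw] at h1
    rw [← h1, hw, Set.indicator_of_mem hy]
    ring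
  have eqq : ∀ y, σ.SameCycle i y →
      μ * v y = ((ρ + 1 : ℝ) : ℂ) * v (σ⁻¹ y) + if y = j then c else 0 := by
    intro y hy
    have h1 := hv y (Or.inr hy)
    have h2 : ∑ x, (B y x : ℂ) * v x = 0 := Finset.sum_eq_zero fun x _ => by
      rw [not_not.1 fun h => hdisj y hy (hBW y x h).1]
      simp
    have h3 : (if y = j₀ then v i else 0) = 0 := by
      split_ifs with h
      · exact hvM i (hij.resolve_right (h ▸ hdisj y hy))
      · rfl
    rw [hsum, if_pos hy, h2, h3] at h1
    rw [← h1]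
    ring
  have finish : (∀ y, σ.SameCycle i y → v y = 0) → w = 0 → v = 0 := by
    intro h1 h2
    ext y
    by_cases hyW : y ∈ W
    · have := congrFun h2 y
      rwa [hw, Set.indicator_of_mem hyW] at this
    · by_cases hy : σ.SameCycle i y
      · exact h1 y hy
      · exact hvW y (by simp [hyW, hy])
  -- For `c = 0` the index is immaterial; choosing `i` sends the resonant case `‖μ‖ = ρ + 1` to the
  -- first branch below.
  wlog hjc : c = 0 → j = i generalizing j
  · have hc0 : c = 0 := by
      by_contra h
      exact hjc fun h' => absurd h' h
    subst hc0
    refine this i ?_ ?_ ?_ fun _ => rfl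
    · simpa using hv
    · simpa using eqW
    · simpa using eqq
  by_cases hcase : ρ < ‖μ‖ ∧ σ.SameCycle i j
  · obtain ⟨hμ, hj⟩ := hcase
    have eqW' : ∀ y ∈ W, μ * w y - ∑ x, (B y x : ℂ) * w x = if y = j₀ then v i else 0 := by
      intro y hy
      rw [eqW y hy, if_neg (fun h : y = j => hdisj j hj (h ▸ hy)), add_zero]
    have hw' : w = 0 := hB μ (v i) j₀ w hw0 hwM eqW' (Or.inr hμ)
    have hvi : v i = 0 := by
      rcases hij with h | h
      · exact hvM i h
      · simpa [hw'] using (eqW' j₀ h).symm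
    exact finish (cycle_eq_zero_of_apply_eq_zero σ i j hj μ c (ρ + 1) (by positivity)
      (norm_pos_iff.1 (hρ.trans_lt hμ)) v hvi eqq) hw'
  · have hq0 : ∀ y, σ.SameCycle i y → v y = 0 := by
      refine cycle_eq_zero_of_norm_ne σ i μ (ρ + 1) (by positivity) ?_ v fun y hy => ?_
      · rintro h
        have h1 : ρ < ‖μ‖ := by linarith
        rcases hc with h0 | h0
        · exact hcase ⟨h1, hjc h0 ▸ Equiv.Perm.SameCycle.refl _ _⟩
        · exact h0.ne' h
      · rw [eqq y hy]
        split_ifs with h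
        · by_cases h0 : c = 0
          · rw [h0, add_zero]
          · exact absurd ⟨by linarith [hc.resolve_left h0], h ▸ hy⟩ hcase
        · rw [add_zero]
    refine finish hq0 (hB μ c j w hw0 hwM (fun y hy => ?_) (hc.imp_right fun h => by linarith))
    rw [eqW y hy, hq0 i (Equiv.Perm.SameCycle.refl _ _), ite_self, zero_add]

/-- If a permutation follows links of a digraph except at nodes of `M`, and every node has a path to
`M`, some matrix supported on the links and the columns in `M` has an injective pencil. -/
theorem exists_pencilInjective {ι : Type*} [Fintype ι] [DecidableEq ι] (G : Digraph ι) (M : Set ι)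
    (σ : Equiv.Perm ι) (hσ : ∀ x, x ∈ M ∨ G.Adj x (σ x))
    (hM : ∀ x, ∃ m ∈ M, HasPath G x m) :
    ∃ (B : Matrix ι ι ℝ) (ρ : ℝ), (∀ y x, B y x ≠ 0 → x ∈ M ∨ G.Adj x y) ∧
      PencilInjective B M Set.univ ρ := by
  let Good : Set ι → Prop := fun W => (∀ y, σ y ∈ W ↔ y ∈ W) ∧ ∃ (B : Matrix ι ι ℝ) (ρ : ℝ),
    0 ≤ ρ ∧ (∀ y x, B y x ≠ 0 → x ∈ M ∨ G.Adj x y) ∧ (∀ y x, B y x ≠ 0 → y ∈ W ∧ x ∈ W) ∧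
      PencilInjective B M W ρ
  have hempty : Good ∅ := ⟨by simp, 0, 0, le_rfl, by simp, by simp,
    fun μ c j v hv _ _ _ => funext fun y => hv y (by simp)⟩
  obtain ⟨W, hW⟩ := (Set.toFinite {W | Good W}).exists_maximal ⟨∅, hempty⟩
  obtain ⟨hWσ, B, ρ, hρ, hBG, hBW, hB⟩ := hW.prop
  suffices hWu : W = Set.univ by exact ⟨B, ρ, hBG, hWu ▸ hB⟩
  by_contra hne
  obtain ⟨u, hu⟩ := (Set.ne_univ_iff_exists_notMem W).1 hne
  -- A path from `u` to `M` enters `W` or ends outside it. In the latter case `j = i` is a filler: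
  -- column `i` only meets `v i = 0`.
  obtain ⟨i, j, hi, hij⟩ : ∃ i j, i ∉ W ∧ (i ∈ M ∧ j = i ∨ G.Adj i j ∧ j ∈ W) := by
    by_contra! hno
    obtain ⟨m, hm, hum⟩ := hM u
    have : m ∉ W := by
      clear hm
      induction hum with
      | refl => exact hu
      | tail _ hbc ih => exact (hno _ _ ih).2 hbc
    exact (hno m m this).1 hm rfl
  refine hi (hW.le_of_ge (y := W ∪ {y | σ.SameCycle i y}) ⟨fun y => ?_, addCycle B σ (ρ + 1) i j,
    ρ + 1, by positivity, fun y x hyx => ?_, fun y x hyx => ?_,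
    hB.of_addCycle hρ hBW σ hWσ i j hi (hij.imp And.left And.right)⟩ Set.subset_union_left
      (Or.inr (Equiv.Perm.SameCycle.refl _ _)))
  · simp [hWσ]
  · rcases addCycle_ne_zero hyx with h | ⟨rfl, -⟩ | ⟨rfl, rfl⟩
    · exact hBG y x h
    · simpa using hσ (σ⁻¹ y)
    · exact hij.imp And.left And.left
  · rcases addCycle_ne_zero hyx with h | ⟨rfl, h⟩ | ⟨rfl, rfl⟩
    · exact ⟨Or.inl (hBW y x h).1, Or.inl (hBW y x h).2⟩
    · exact ⟨Or.inr h, Or.inr (by simpa using h)⟩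
    · refine ⟨?_, Or.inr (Equiv.Perm.SameCycle.refl _ _)⟩
      rcases hij with ⟨-, rfl⟩ | h
      · exact Or.inr (Equiv.Perm.SameCycle.refl _ _)
      · exact Or.inl h.2

/-! ### Digraph lemmas -/

/-- In a finite digraph every node has a path into some parent strongly connected component. -/
theorem exists_parentSCC {V : Type*} [Finite V] (G : Digraph V) (u : V) :
    ∃ S, IsParentSCC G S ∧ ∀ x ∈ S, HasPath G u x := by
  -- A node reachable from `u` with minimal reachable set is reachable back from all its
  -- descendants.
  obtain ⟨w, hw⟩ := (Set.toFinite {w | HasPath G u w}).exists_minimalFor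
    (fun w => {x | HasPath G w x}) _ ⟨u, Relation.ReflTransGen.refl⟩
  refine ⟨{j | HasPath G w j ∧ HasPath G j w}, ⟨⟨w, rfl⟩, ?_⟩, fun x hx => hw.prop.trans hx.1⟩
  rintro T ⟨t, rfl⟩ hne i hi j hj hadj
  have hwj : HasPath G w j := hi.1.tail hadj
  have hjw : HasPath G j w :=
    hw.le_of_le (j := j) (hw.prop.trans hwj) (fun x hx => hwj.trans hx) Relation.ReflTransGen.refl
  refine hne (Set.ext fun x => ⟨fun hx => ?_, fun hx => ?_⟩)
  · exact ⟨hwj.trans (hj.2.trans hx.1), hx.2.trans (hj.1.trans hjw)⟩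
  · exact ⟨hj.1.trans (hjw.trans hx.1), hx.2.trans (hwj.trans hj.2)⟩

/-- If every contraction meets `M`, some permutation follows links except at nodes of `M`. -/
theorem exists_perm_of_contraction {V : Type*} [Fintype V] (G : Digraph V) (M : Set V)
    (h : ∀ K, IsContraction G K → (K ∩ M).Nonempty) :
    ∃ σ : Equiv.Perm V, ∀ x, x ∈ M ∨ G.Adj x (σ x) := by
  classical
  -- Hall's condition: nodes of `M` may go anywhere, so only sets disjoint from `M` matter, and
  -- these are not contractions.
  have hall : ∀ K : Finset V, K.card ≤
      (Finset.univ.filter fun y => ∃ x ∈ K, x ∈ M ∨ G.Adj x y).card := by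
    intro K
    by_cases hK : ∃ x ∈ K, x ∈ M
    · obtain ⟨x, hxK, hxM⟩ := hK
      rw [Finset.filter_true_of_mem fun y _ => ⟨x, hxK, Or.inl hxM⟩]
      exact K.card_le_univ
    · have h1 : ¬ IsContraction G K := fun h2 => by
        obtain ⟨x, hx⟩ := h K h2
        exact hK ⟨x, by simpa using hx.1, hx.2⟩
      rw [IsContraction, not_lt, Set.ncard_coe_finset] at h1
      refine h1.trans ?_
      rw [← Set.ncard_coe_finset]
      refine Set.ncard_le_ncard ?_
      rintro y ⟨x, hx, hxy⟩
      simpa using ⟨x, hx, Or.inr hxy⟩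
  obtain ⟨f, hf, hfM⟩ := (Fintype.all_card_le_filter_rel_iff_exists_injective
    fun x y => x ∈ M ∨ G.Adj x y).1 hall
  exact ⟨Equiv.ofBijective f (Finite.injective_iff_bijective.1 hf), hfM⟩

/-! ### Lin's criterion and sensor removal -/

/-- Lin's criterion for state outputs: if every parent strongly connected component and every
contraction contains a measured node, the pair is structurally observable. -/
theorem structurallyObservable_of_measured {ι κ : Type*} [Fintype ι] [DecidableEq ι] [Fintype κ]
    (A : Matrix ι ι ℝ) (C : Matrix κ ι ℝ) (s : κ → ι) (hC : IsStateOutputMatrix C s)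
    (hSCC : ∀ S, IsParentSCC (systemDigraph A) S → (S ∩ Set.range s).Nonempty)
    (hContr : ∀ K, IsContraction (systemDigraph A) K → (K ∩ Set.range s).Nonempty) :
    StructurallyObservable A C := by
  classical
  obtain ⟨σ, hσ⟩ := exists_perm_of_contraction _ _ hContr
  obtain ⟨B, ρ, hBG, hB⟩ := exists_pencilInjective _ _ σ hσ fun x => by
    obtain ⟨S, hS, hxS⟩ := exists_parentSCC (systemDigraph A) x
    obtain ⟨m, hmS, hm⟩ := hSCC S hS
    exact ⟨m, hm, hxS m hmS⟩
  refine structurallyObservable_of_exists A C ⟨Sum.elim (fun e => B e.1.1 e.1.2) fun _ => 1,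
    pairObservable_of_eigenvector _ _ fun μ v hv hCv => ?_⟩
  have hvM : ∀ m ∈ Set.range s, v m = 0 := by
    rintro _ ⟨k, rfl⟩
    have hrow : ∀ x, ((realizeC A C (Sum.elim (fun e => B e.1.1 e.1.2) fun _ => 1)).map
        (algebraMap ℝ ℂ)) k x = if x = s k then 1 else 0 := fun x => by
      by_cases hx : x = s k <;> simp [realizeC, hC k, hx]
    simpa only [Matrix.mulVec, dotProduct, hrow, ite_mul, one_mul, zero_mul, Finset.sum_ite_eq',
      Finset.mem_univ, if_true, Pi.zero_apply] using congrFun hCv k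
  refine funext fun j => congrFun (hB μ 0 j v (by simp) hvM (fun y _ => ?_) (Or.inl rfl)) j
  rw [ite_self, sub_eq_zero]
  have h1 := congrFun hv y
  rw [Pi.smul_apply, smul_eq_mul] at h1
  rw [← h1]
  refine Finset.sum_congr rfl fun x _ => ?_
  simp only [realizeA, Matrix.map_apply, Matrix.of_apply]
  split_ifs with h
  · rfl
  -- Entries of `B` outside the pattern of `A` lie in measured columns, where `v` vanishes.
  · by_cases hx : x ∈ Set.range s
    · simp [hvM x hx]
    · have : B y x = 0 := by
        by_contra hne
        exact (hBG y x hne).elim hx h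
      simp [this]

theorem mainTheorem1 (n N Q : ℕ)
    (A : Matrix (Fin n) (Fin n) ℝ) (C : Matrix (Fin N) (Fin n) ℝ)
    (s : Fin N → Fin n) (hC : IsStateOutputMatrix C s)
    (hSCC : ∀ S : Set (Fin n), IsParentSCC (systemDigraph A) S →
      Q + 1 ≤ (S ∩ Set.range s).ncard)
    (hContr : ∀ K : Set (Fin n), IsContraction (systemDigraph A) K →
      Q + 1 ≤ (K ∩ Set.range s).ncard) :
    ∀ R : Finset (Fin N), R.card ≤ Q → StructurallyObservable A (removeRows C R) := by
  intro R hR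
  have key : ∀ K : Set (Fin n), Q + 1 ≤ (K ∩ Set.range s).ncard →
      (K ∩ Set.range fun i : {i : Fin N // i ∉ R} => s i).Nonempty := by
    intro K hK
    have hlt : (s '' (R : Set (Fin N))).ncard < (K ∩ Set.range s).ncard := by
      have := Set.ncard_image_le (f := s) R.finite_toSet
      rw [Set.ncard_coe_finset] at this
      omega
    obtain ⟨x, ⟨hxK, i, rfl⟩, hx⟩ := Set.exists_mem_notMem_of_ncard_lt_ncard hlt
    exact ⟨s i, hxK, ⟨i, fun hi => hx ⟨i, hi, rfl⟩⟩, rfl⟩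
  exact structurallyObservable_of_measured A (removeRows C R) (fun i => s i)
    (fun i j => hC i j) (fun S hS => key S (hSCC S hS)) fun K hK => key K (hContr K hK)
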